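/- **Proposition 3.2.** Let $n\ge 0$ and let $\Gamma_0(\mathbb R^n)$ be the set of proper, convex, lower semicontinuous functions $\mathbb R^n\to\mathbb R\cup\{+\infty\}$. For $f\colon\mathbb R^n\to\mathbb R\cup\{+\infty\}$ write $\operatorname{dom} f=\{x: f(x)<+\infty\}$, $f^*(p)=\sup_{x}\{\langle p,x\rangle-f(x)\}$ and $\partial f(x)=\{p: f(y)\ge f(x)+\langle p,y-x\rangle\ \forall y\in\mathbb R^n\}$, and for a set $C$ let $I_C$ be $0$ on $C$ and $+\infty$ off $C$. Let $J,H\in\Gamma_0(\mathbb R^n)$ be such that * $J$ is 1-coercive, i.e. $J(x)/\|x\|\to+\infty$ as $\|x\|\to+\infty$; * $H$ is a Legendre function, i.e. $\operatorname{int}\operatorname{dom}H\neq\emptyset$, $H$ is differentiable and strictly convex on $\operatorname{int}\operatorname{dom}H$, $\partial H(p)=\{\nabla H(p)\}$ for $p\in\operatorname{int}\operatorname{dom}H$, and $\partial H(p)=\emptyset$ for $p\in\operatorname{dom}H\setminus\operatorname{int}\operatorname{dom}H$. Define $S$ on $\mathbb R^n\times\mathbb R$ by $$S(x,t)=\begin{cases}\inf_{v\in\mathbb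 R^n}\{J(x-tv)+tH^*(v)\},& t>0,\\ (J^*+I_{\operatorname{dom}H})^*(x),& t=0,\\ +\infty,& t<0.\end{cases}$$ Then $S$ takes values in $\mathbb R\cup\{+\infty\}$, and the following hold. 1. There is a function $J_S\in\Gamma_0(\mathbb R^n)$ whose transform satisfies $\operatorname{dom}J_S^*=\operatorname{cl}\operatorname{dom}H$ and $J_S^*=J^*$ on $\operatorname{dom}J_S^*$. For every such $J_S$, $S$ solves $$\begin{cases}\dfrac{\partial S}{\partial t}(x,t)+H(\nabla_xS(x,t))=0,&(x,t)\in\operatorname{int}\operatorname{dom}S,\\ S(x,0)=J_S(x),&x\in\mathbb R^n,\end{cases}$$ in the classical sense: $S$ is differentiable at every point of $\operatorname{int}\operatorname{dom}S$, and the equation holds there (in particular $H(\nabla_xS(x,t))$ is finite). 2. For all $t>0$ and $x\in\operatorname{dom}J+t\operatorname{int}\operatorname{dom}H^*$, one has $(x,t)\in\operatorname{int}\operatorname{dom}S$ and $\nabla_xS(x,t)\in\operatorname{int}\operatorname{dom}H$, and the problem $\min_{v\in\mathbb R^n}\{J(x-tv)+tH^*(v)\}$ has a unique minimizer $\bar v$,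 given by $$\bar v=\nabla H(\nabla_xS(x,t)).$$ -/

import Mathlib

open Filter Topology
open scoped Pointwise Gradient

noncomputable section

namespace HJ

/-- Effective domain `dom f = {x | f x < +∞}`. -/
def dom {X : Type*} (f : X → EReal) : Set X := {x | f x < ⊤}

/-- The real-valued representative of an extended-real-valued function. It is only differentiated
at points near which `f` is finite. -/
def re {X : Type*} (f : X → EReal) : X → ℝ := fun x => (f x).toReal

/-- The indicator function of convex analysis: `0` on `C` and `+∞` off `C`. -/
def ind {X : Type*} (C : Set X) : X → EReal :=
  open scoped Classical in fun x => if x ∈ C then 0 else ⊤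

/-- `Γ₀(ℝⁿ)`: proper, convex, lower semicontinuous functions `ℝⁿ → ℝ ∪ {+∞}`. -/
structure Gamma0 {n : ℕ} (f : EuclideanSpace ℝ (Fin n) → EReal) : Prop where
  ne_bot : ∀ x, f x ≠ ⊥
  dom_nonempty : (dom f).Nonempty
  convex : ∀ x y : EuclideanSpace ℝ (Fin n), ∀ a b : ℝ, 0 < a → 0 < b → a + b = 1 →
    f (a • x + b • y) ≤ (a : EReal) * f x + (b : EReal) * f y
  lsc : LowerSemicontinuous f

/-- Legendre-Fenchel transform `f*(p) = sup_x {⟨p, x⟩ - f(x)}`. -/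
def conj {n : ℕ} (f : EuclideanSpace ℝ (Fin n) → EReal) (p : EuclideanSpace ℝ (Fin n)) : EReal :=
  ⨆ x : EuclideanSpace ℝ (Fin n), ((inner ℝ p x : ℝ) : EReal) - f x

/-- Subdifferential `∂f(x) = {p | f(y) ≥ f(x) + ⟨p, y - x⟩ for all y}`. -/
def subdiff {n : ℕ} (f : EuclideanSpace ℝ (Fin n) → EReal) (x : EuclideanSpace ℝ (Fin n)) :
    Set (EuclideanSpace ℝ (Fin n)) :=
  {p | ∀ y, f x + ((inner ℝ p (y - x) : ℝ) : EReal) ≤ f y}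

/-- 1-coercivity: `f(x)/‖x‖ → +∞` as `‖x‖ → +∞`. -/
def OneCoercive {n : ℕ} (f : EuclideanSpace ℝ (Fin n) → EReal) : Prop :=
  Tendsto (fun x => f x / ((‖x‖ : ℝ) : EReal))
    (Bornology.cobounded (EuclideanSpace ℝ (Fin n))) (𝓝 ⊤)

/-- Convex functions of Legendre type. -/
structure IsLegendre {n : ℕ} (f : EuclideanSpace ℝ (Fin n) → EReal) : Prop where
  gamma0 : Gamma0 f
  interior_nonempty : (interior (dom f)).Nonempty
  differentiable : ∀ x ∈ interior (dom f), DifferentiableAt ℝ (re f) x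
  subdiff_boundary : ∀ x ∈ dom f \ interior (dom f), subdiff f x = ∅
  subdiff_interior : ∀ x ∈ interior (dom f), subdiff f x = {∇ (re f) x}
  strictConvex : StrictConvexOn ℝ (interior (dom f)) (re f)

/-- The objective `v ↦ J(x - t v) + t H*(v)` of the additive model. -/
def additiveObjective {n : ℕ} (J H : EuclideanSpace ℝ (Fin n) → EReal)
    (x : EuclideanSpace ℝ (Fin n)) (t : ℝ) (v : EuclideanSpace ℝ (Fin n)) : EReal :=
  J (x - t • v) + (t : EReal) * conj H v

/-- The value function `S` on `ℝⁿ × ℝ`, with its extension to `t ≤ 0`. -/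
def valueFn {n : ℕ} (J H : EuclideanSpace ℝ (Fin n) → EReal)
    (z : EuclideanSpace ℝ (Fin n) × ℝ) : EReal :=
  if 0 < z.2 then ⨅ v, additiveObjective J H z.1 z.2 v
  else if z.2 = 0 then conj (fun p => conj J p + ind (dom H) p) z.1
  else ⊤

/-- Spatial gradient `∇ₓ S(x, t)`. -/
def gradX {n : ℕ} (S : EuclideanSpace ℝ (Fin n) × ℝ → EReal)
    (x : EuclideanSpace ℝ (Fin n)) (t : ℝ) : EuclideanSpace ℝ (Fin n) :=
  ∇ (fun y => re S (y, t)) x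

/-- Time derivative `∂S/∂t (x, t)`. -/
def partialT {n : ℕ} (S : EuclideanSpace ℝ (Fin n) × ℝ → EReal)
    (x : EuclideanSpace ℝ (Fin n)) (t : ℝ) : ℝ :=
  deriv (fun s => re S (x, s)) t

/-- `S` is a classical solution of `∂S/∂t + H(∇ₓ S) = 0` on `int dom S` with `S(·, 0) = J₀`:
at every point of `int dom S` it is (jointly) differentiable and satisfies the equation. The
equation is read in the extended reals, so it includes that `H(∇ₓ S(x, t))` is finite. -/
def SolvesHJ {n : ℕ} (H : EuclideanSpace ℝ (Fin n) → EReal)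
    (S : EuclideanSpace ℝ (Fin n) × ℝ → EReal) (J₀ : EuclideanSpace ℝ (Fin n) → EReal) : Prop :=
  (∀ (x : EuclideanSpace ℝ (Fin n)) (t : ℝ), (x, t) ∈ interior (dom S) →
    DifferentiableAt ℝ (re S) (x, t) ∧
      (partialT S x t : EReal) + H (gradX S x t) = 0) ∧
  ∀ x, S (x, 0) = J₀ x

/-- The defining property of the initial datum `J_S`: it belongs to `Γ₀(ℝⁿ)`,
`dom J_S* = cl dom H`, and `J_S* = J*` on `dom J_S*`. -/
structure IsInitialDatum {n : ℕ} (J H JS : EuclideanSpace ℝ (Fin n) → EReal) : Prop where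
  gamma0 : Gamma0 JS
  dom_conj : dom (conj JS) = closure (dom H)
  conj_eq : ∀ p ∈ dom (conj JS), conj JS p = conj J p

end HJ

end

/-! The proof is convex duality. Coercivity makes `conj J` finite everywhere, hence continuous, and
for t ≥ 0 the value function S is the supremum over p ∈ dom H of the affine functions ⟨p, x⟩ - t
H(p) - J*(p) (`valueFn_le_coe_iff`). For t > 0 this is Fenchel duality with attainment, obtained by
placing an affine function between a concave and a continuous convex one. So S is convex and never
-∞.

At an interior point (x, t) take a subgradient (p, τ) of S and a minimizer v, and put y = x - tv.
The bound S(y + sw, s) ≤ J(y) + s H*(w) is an equality at w = v, s = t. Varying w gives p ∈ ∂H*(v),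
that is v ∈ ∂H(p); varying s gives τ = H*(v) - ⟨p, v⟩ = -H(p) (`subgradient_valueFn`). Thus every
subgradient already satisfies the equation.

The Legendre property makes the subgradient unique: ∂H(p) ≠ ∅ puts p in int dom H, and strict
convexity there forbids a common v ∈ ∂H(p) ∩ ∂H(q) with p ≠ q. A convex function with a unique
subgradient is differentiable, and then any minimizer lies in ∂H(∇ₓS) = {∇H(∇ₓS)}.

For the initial datum, continuity of J* allows dom H to be replaced by its closure, and
Fenchel-Moreau identifies the result with J_S. -/

noncomputable section

namespace HJ

/-! ### Separation and subgradients of finite convex functions -/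

section Convex

variable {F : Type*} [NormedAddCommGroup F] [NormedSpace ℝ F]

/-- Sandwich theorem: a concave function below a continuous convex function is separated from it
by a continuous affine function. -/
theorem exists_affine_between {U C : Set F} {f h : F → ℝ} (hU : IsOpen U)
    (hf : ConvexOn ℝ U f) (hfc : ContinuousOn f U) (hh : ConcaveOn ℝ C h)
    (hCU : (C ∩ U).Nonempty) (hle : ∀ x ∈ C ∩ U, h x ≤ f x) :
    ∃ (l : F →L[ℝ] ℝ) (b : ℝ), (∀ x ∈ C, h x ≤ l x + b) ∧ ∀ x ∈ U, l x + b ≤ f x := by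
  have hopen : IsOpen {p : F × ℝ | p.1 ∈ U ∧ f p.1 < p.2} := by
    have h1 : ContinuousOn (fun p : F × ℝ => p.2 - f p.1) (Prod.fst ⁻¹' U) :=
      continuous_snd.continuousOn.sub
        (hfc.comp continuous_fst.continuousOn fun p hp => hp)
    have h2 := h1.isOpen_inter_preimage (hU.preimage continuous_fst) (isOpen_Ioi (a := (0 : ℝ)))
    convert h2 using 1
    ext p
    simp
  have hdisj : Disjoint {p : F × ℝ | p.1 ∈ U ∧ f p.1 < p.2}
      {p : F × ℝ | p.1 ∈ C ∧ p.2 ≤ h p.1} := by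
    rw [Set.disjoint_left]
    rintro ⟨x, r⟩ ⟨hx, hr⟩ ⟨hx', hr'⟩
    exact absurd (hle x ⟨hx', hx⟩) (not_le.2 (lt_of_lt_of_le hr hr'))
  obtain ⟨L, u, hA, hB⟩ := geometric_hahn_banach_open hf.convex_strict_epigraph hopen
    hh.convex_hypograph hdisj
  set m : F →L[ℝ] ℝ := L.comp (.inl ℝ F ℝ) with hm
  set a : ℝ := L (0, 1) with ha
  have hL : ∀ x r, L (x, r) = m x + r * a := by
    intro x r
    have : ((x, r) : F × ℝ) = (x, 0) + r • (0, 1) := by simp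
    rw [this, map_add, map_smul]
    simp [hm, ha]
  obtain ⟨x₀, hx₀, hx₀'⟩ := hCU
  -- The common point x₀ excludes a vertical hyperplane: both separated sets have points above x₀,
  -- at different heights.
  have hneg : a < 0 := by
    have h1 := hA (x₀, f x₀ + 1) ⟨hx₀', by simp⟩
    have h2 := hB (x₀, h x₀) ⟨hx₀, le_rfl⟩
    rw [hL] at h1 h2
    have h3 := hle x₀ ⟨hx₀, hx₀'⟩
    by_contra! h4
    nlinarith
  refine ⟨(-a)⁻¹ • m, -((-a)⁻¹ * u), fun x hx => ?_, fun x hx => ?_⟩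
  · have h2 := hB (x, h x) ⟨hx, le_rfl⟩
    rw [hL] at h2
    have : h x ≤ (-a)⁻¹ * (m x - u) := by
      rw [le_inv_mul_iff₀ (by linarith)]
      linarith
    simp only [smul_apply, smul_eq_mul]
    linarith
  · have : (-a)⁻¹ * (m x - u) ≤ f x := by
      rw [inv_mul_le_iff₀ (by linarith)]
      refine le_of_forall_pos_lt_add fun ε hε => ?_
      have h1 := hA (x, f x + ε / (-a)) ⟨hx, by simp; exact div_pos hε (by linarith)⟩
      rw [hL, add_mul] at h1
      have h3 : ε / (-a) * a = -ε := by
        rw [div_neg, neg_mul, div_mul_cancel₀ _ hneg.ne]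
      linarith
    simp only [smul_apply, smul_eq_mul]
    linarith

variable [FiniteDimensional ℝ F]

theorem exists_subgradient {U : Set F} {g : F → ℝ} (hU : IsOpen U) (hg : ConvexOn ℝ U g)
    {z : F} (hz : z ∈ U) : ∃ l : F →L[ℝ] ℝ, ∀ w ∈ U, g z + l (w - z) ≤ g w := by
  obtain ⟨l, b, h1, h2⟩ := exists_affine_between (C := {z}) (h := fun _ => g z) hU hg
    (hg.continuousOn hU) ⟨convex_singleton z, by simp [← add_mul]; intros; simp_all⟩
    ⟨z, rfl, hz⟩ (by rintro x ⟨rfl, -⟩; rfl)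
  refine ⟨l, fun w hw => ?_⟩
  have := h1 z rfl
  have := h2 w hw
  rw [map_sub]
  linarith

/-- A finite convex function on an open set is differentiable where its subgradient is unique. -/
theorem hasFDerivAt_of_unique_subgradient {U : Set F} {g : F → ℝ} (hU : IsOpen U)
    (hg : ConvexOn ℝ U g) {z : F} (hz : z ∈ U) {l : F →L[ℝ] ℝ}
    (hl : ∀ l' : F →L[ℝ] ℝ, (∀ w ∈ U, g z + l' (w - z) ≤ g w) → l' = l) :
    HasFDerivAt g l z := by
  have hsub : ∀ w ∈ U, g z + l (w - z) ≤ g w := by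
    obtain ⟨l', hl'⟩ := exists_subgradient hU hg hz
    rwa [← hl l' hl']
  obtain ⟨K, t, ht, hK⟩ := hg.locallyLipschitzOn hU hz
  rw [hU.nhdsWithin_eq hz] at ht
  obtain ⟨V, hVt, hV, hzV⟩ := mem_nhds_iff.1 (inter_mem ht (hU.mem_nhds hz))
  -- Subgradients near z are bounded by the local Lipschitz constant, so sequences of them have
  -- convergent subsequences.
  have hbound : ∀ w ∈ V, ∀ m : F →L[ℝ] ℝ, (∀ y ∈ U, g w + m (y - w) ≤ g y) → ‖m‖ ≤ K := by
    intro w hw m hm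
    obtain ⟨ε, hε, hball⟩ := Metric.isOpen_iff.1 hV w hw
    refine ContinuousLinearMap.opNorm_le_of_ball hε K.coe_nonneg fun y hy => ?_
    have key : ∀ y ∈ Metric.ball (0 : F) ε, m y ≤ K * ‖y‖ := by
      intro y hy
      have hwy : w + y ∈ V := hball (by simpa using hy)
      have h1 := hm _ (hVt hwy).2
      have h2 := hK.dist_le_mul _ (hVt hwy).1 _ (hVt hw).1
      rw [Real.dist_eq, dist_eq_norm] at h2
      simp only [add_sub_cancel_left] at h1 h2
      linarith [le_abs_self (g (w + y) - g w)]
    rw [Real.norm_eq_abs, abs_le]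
    have h1 := key y hy
    have h2 := key (-y) (by simpa using hy)
    rw [map_neg, norm_neg] at h2
    constructor <;> linarith
  rw [hasFDerivAt_iff_isLittleO, Asymptotics.isLittleO_iff]
  intro ε hε
  by_contra hcon
  rw [not_eventually] at hcon
  obtain ⟨w, hw, hwP⟩ := exists_seq_forall_of_frequently (hcon.and_eventually (hV.mem_nhds hzV))
  choose m hm using fun k => exists_subgradient hU hg (hVt (hwP k).2).2
  have hmK : ∀ k, m k ∈ Metric.closedBall (0 : F →L[ℝ] ℝ) K := fun k => by
    simpa using hbound _ (hwP k).2 _ (hm k)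
  have : ProperSpace (F →L[ℝ] ℝ) := FiniteDimensional.proper ℝ _
  obtain ⟨m₀, -, φ, hφ, hlim⟩ := (isCompact_closedBall _ _).tendsto_subseq hmK
  have hwφ := hw.comp hφ.tendsto_atTop
  have hgz : ContinuousAt g z := (hg.continuousOn hU).continuousAt (hU.mem_nhds hz)
  -- The subgradient inequality passes to the limit, so uniqueness at z identifies every cluster
  -- point.
  have hm₀ : m₀ = l := by
    refine hl _ fun y hy => ?_
    have h1 : Tendsto (fun k => g (w (φ k)) + (m (φ k)) (y - w (φ k))) atTop
        (𝓝 (g z + m₀ (y - z))) := by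
      refine (hgz.tendsto.comp hwφ).add ?_
      exact (isBoundedBilinearMap_apply.continuous.tendsto (m₀, y - z)).comp
        (hlim.prodMk_nhds (tendsto_const_nhds.sub hwφ))
    exact le_of_tendsto h1 (Eventually.of_forall fun k => hm _ y hy)
  subst hm₀
  have hev : ∀ᶠ k in atTop, ‖m (φ k) - m₀‖ < ε := by
    have := (tendsto_iff_norm_sub_tendsto_zero.1 hlim)
    exact this.eventually (gt_mem_nhds hε)
  obtain ⟨k, hk⟩ := hev.exists
  -- The remainder at w is nonnegative by the subgradient at z, and at most (m - l)(w - z) by the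
  -- subgradient m at w.
  refine (hwP (φ k)).1 ?_
  have h1 := hm (φ k) z hz
  have h2 := hsub (w (φ k)) (hVt (hwP (φ k)).2).2
  have h3 := (m (φ k) - m₀).le_opNorm (w (φ k) - z)
  have h4 : ‖m (φ k) - m₀‖ * ‖w (φ k) - z‖ ≤ ε * ‖w (φ k) - z‖ := by gcongr
  have h5 : m (φ k) (z - w (φ k)) = - m (φ k) (w (φ k) - z) := by rw [← map_neg, neg_sub]
  rw [Real.norm_eq_abs] at h3 ⊢
  rw [sub_apply] at h3
  rw [abs_le]
  have := le_abs_self (m (φ k) (w (φ k) - z) - m₀ (w (φ k) - z))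
  constructor <;> linarith [norm_nonneg (w (φ k) - z)]

end Convex

/-! ### Legendre-Fenchel transform and Fenchel-Moreau -/

section Conjugate

variable {n : ℕ} {f g : EuclideanSpace ℝ (Fin n) → EReal}

theorem coe_sub_le_coe_iff {a c : ℝ} {u : EReal} :
    (a : EReal) - u ≤ c ↔ ((a - c : ℝ) : EReal) ≤ u := by
  induction u with
  | bot => simpa using EReal.coe_ne_bot (a - c)
  | top => simp
  | coe r => norm_cast; constructor <;> intro h <;> linarith

/-- Testing against real bounds c avoids subtraction in `EReal`; most later estimates of conjugates
go through this form. -/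
theorem conj_le_coe_iff {p : EuclideanSpace ℝ (Fin n)} {c : ℝ} :
    conj f p ≤ c ↔ ∀ x, ((inner ℝ p x - c : ℝ) : EReal) ≤ f x := by
  simp only [conj, iSup_le_iff, coe_sub_le_coe_iff]

theorem Gamma0.coe_re (hf : Gamma0 f) {x : EuclideanSpace ℝ (Fin n)} (hx : x ∈ dom f) :
    ((re f x : ℝ) : EReal) = f x :=
  EReal.coe_toReal (ne_of_lt hx) (hf.ne_bot x)

theorem Gamma0.convexOn_re (hf : Gamma0 f) : ConvexOn ℝ (dom f) (re f) := by
  have key : ∀ x ∈ dom f, ∀ y ∈ dom f, ∀ a b : ℝ, 0 < a → 0 < b → a + b = 1 →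
      f (a • x + b • y) ≤ ((a * re f x + b * re f y : ℝ) : EReal) := by
    intro x hx y hy a b ha hb hab
    have := hf.convex x y a b ha hb hab
    rw [← hf.coe_re hx, ← hf.coe_re hy] at this
    exact_mod_cast this
  refine convexOn_iff_forall_pos.2 ⟨convex_iff_forall_pos.2 fun x hx y hy a b ha hb hab =>
    (key x hx y hy a b ha hb hab).trans_lt (EReal.coe_lt_top _),
    fun x hx y hy a b ha hb hab => ?_⟩
  have h := key x hx y hy a b ha hb hab
  have hd : a • x + b • y ∈ dom f := h.trans_lt (EReal.coe_lt_top _)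
  rw [← hf.coe_re hd] at h
  exact_mod_cast h

/-- Below a value of a function in `Γ₀` passes an affine minorant. -/
theorem Gamma0.exists_affine_minorant_gt (hf : Gamma0 f) {x : EuclideanSpace ℝ (Fin n)} {r : ℝ}
    (hr : (r : EReal) < f x) : ∃ (p : EuclideanSpace ℝ (Fin n)) (b : ℝ),
      (∀ y, ((inner ℝ p y + b : ℝ) : EReal) ≤ f y) ∧ r < inner ℝ p x + b := by
  have hclosed : IsClosed {q : EuclideanSpace ℝ (Fin n) × ℝ | f q.1 ≤ q.2} :=
    hf.lsc.isClosed_epigraph.preimage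
      (continuous_fst.prodMk (continuous_coe_real_ereal.comp continuous_snd))
  have hconv : Convex ℝ {q : EuclideanSpace ℝ (Fin n) × ℝ | f q.1 ≤ q.2} := by
    convert hf.convexOn_re.convex_epigraph using 1
    ext ⟨y, s⟩
    constructor
    · intro (h : f y ≤ s)
      have hy : y ∈ dom f := h.trans_lt (EReal.coe_lt_top s)
      rw [← hf.coe_re hy] at h
      exact ⟨hy, by exact_mod_cast h⟩
    · rintro ⟨hy : y ∈ dom f, h : re f y ≤ s⟩
      change f y ≤ s
      rw [← hf.coe_re hy]
      exact_mod_cast h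
  have sep : ∀ (x : EuclideanSpace ℝ (Fin n)) (r : ℝ), (r : EReal) < f x →
      ∃ (m : EuclideanSpace ℝ (Fin n)) (a u : ℝ), inner ℝ m x + r * a < u ∧
        ∀ y ∈ dom f, ∀ s, re f y ≤ s → u < inner ℝ m y + s * a := by
    intro x r hr
    obtain ⟨L, u, h1, h2⟩ := geometric_hahn_banach_point_closed hconv hclosed
      (show (x, r) ∉ _ from not_le.2 hr)
    have hL : ∀ y s, L (y, s) = inner ℝ ((InnerProductSpace.toDual ℝ _).symm
        (L.comp (.inl ℝ (EuclideanSpace ℝ (Fin n)) ℝ))) y + s * L (0, 1) := by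
      intro y s
      have : ((y, s) : EuclideanSpace ℝ (Fin n) × ℝ) = (y, 0) + s • (0, 1) := by simp
      rw [this, map_add, map_smul]
      simp
    refine ⟨_, _, u, by rw [← hL]; exact h1, fun y hy s hs => ?_⟩
    rw [← hL]
    refine h2 (y, s) (show f y ≤ s from ?_)
    rw [← hf.coe_re hy]
    exact_mod_cast hs
  have sep_pos : ∀ (x : EuclideanSpace ℝ (Fin n)) (r : ℝ) (m : EuclideanSpace ℝ (Fin n))
      (a u : ℝ), 0 < a → inner ℝ m x + r * a < u →
      (∀ y ∈ dom f, ∀ s, re f y ≤ s → u < inner ℝ m y + s * a) →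
      ∃ (p : EuclideanSpace ℝ (Fin n)) (b : ℝ),
        (∀ y ∈ dom f, inner ℝ p y + b ≤ re f y) ∧ r < inner ℝ p x + b := by
    intro x r m a u ha h1 h2
    refine ⟨-(a⁻¹ • m), a⁻¹ * u, fun y hy => ?_, ?_⟩
    · have := h2 y hy _ le_rfl
      rw [inner_neg_left, inner_smul_left, RCLike.conj_to_real]
      have : a⁻¹ * (u - inner ℝ m y) ≤ re f y := by
        rw [inv_mul_le_iff₀ ha]; linarith
      linarith
    · rw [inner_neg_left, inner_smul_left, RCLike.conj_to_real]
      have : r < a⁻¹ * (u - inner ℝ m x) := by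
        rw [lt_inv_mul_iff₀ ha]; linarith
      linarith
  have nonneg : ∀ (m : EuclideanSpace ℝ (Fin n)) (a u : ℝ),
      (∀ y ∈ dom f, ∀ s, re f y ≤ s → u < inner ℝ m y + s * a) → 0 ≤ a := by
    intro m a u h
    obtain ⟨y, hy⟩ := hf.dom_nonempty
    by_contra! ha
    have h1 := h y hy (max (re f y) ((inner ℝ m y - u) / (-a))) (le_max_left _ _)
    have h2 := le_max_right (re f y) ((inner ℝ m y - u) / (-a))
    rw [div_le_iff₀ (by linarith)] at h2
    linarith
  suffices h : ∃ (p : EuclideanSpace ℝ (Fin n)) (b : ℝ),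
      (∀ y ∈ dom f, inner ℝ p y + b ≤ re f y) ∧ r < inner ℝ p x + b by
    obtain ⟨p, b, h1, h2⟩ := h
    refine ⟨p, b, fun y => ?_, h2⟩
    by_cases hy : y ∈ dom f
    · rw [← hf.coe_re hy]
      exact_mod_cast h1 y hy
    · rw [show f y = ⊤ from not_lt_top_iff.1 hy]
      exact le_top
  obtain ⟨m, a, u, h1, h2⟩ := sep x r hr
  rcases (nonneg m a u h2).lt_or_eq with ha | rfl
  · exact sep_pos x r m a u ha h1 h2
  -- Vertical hyperplane: start from any affine minorant, found by separating a point just below the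
  -- graph, and tilt it by a large multiple of the vertical separator.
  · obtain ⟨p₀, b₀, h₀⟩ : ∃ (p : EuclideanSpace ℝ (Fin n)) (b : ℝ),
        ∀ y ∈ dom f, inner ℝ p y + b ≤ re f y := by
      obtain ⟨y, hy⟩ := hf.dom_nonempty
      obtain ⟨m', a', u', h1', h2'⟩ := sep y (re f y - 1) (by
        rw [← hf.coe_re hy]; exact_mod_cast (by linarith : re f y - 1 < re f y))
      have ha' : 0 < a' := by
        have := h2' y hy _ le_rfl
        linarith
      obtain ⟨p, b, h, -⟩ := sep_pos _ _ m' a' u' ha' h1' h2'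
      exact ⟨p, b, h⟩
    have hu : 0 < u - inner ℝ m x := by linarith
    -- The gain k (u - ⟨m, x⟩) at x then exceeds the missing height r - ⟨p₀, x⟩ - b₀ by at least 1.
    set k : ℝ := (|r - inner ℝ p₀ x - b₀| + 1) / (u - inner ℝ m x) with hk
    have hk0 : 0 < k := by positivity
    refine ⟨p₀ - k • m, b₀ + k * u, fun y hy => ?_, ?_⟩
    · have h3 := h₀ y hy
      have h4 := h2 y hy _ le_rfl
      rw [inner_sub_left, inner_smul_left, RCLike.conj_to_real]
      nlinarith
    · have h5 : k * (u - inner ℝ m x) = |r - inner ℝ p₀ x - b₀| + 1 :=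
        div_mul_cancel₀ _ hu.ne'
      rw [inner_sub_left, inner_smul_left, RCLike.conj_to_real]
      linarith [le_abs_self (r - inner ℝ p₀ x - b₀)]

theorem Gamma0.exists_affine_minorant (hf : Gamma0 f) :
    ∃ (p : EuclideanSpace ℝ (Fin n)) (b : ℝ), ∀ y, ((inner ℝ p y + b : ℝ) : EReal) ≤ f y := by
  obtain ⟨x, hx⟩ := hf.dom_nonempty
  obtain ⟨r, -, hr⟩ := EReal.lt_iff_exists_real_btwn.1 (bot_lt_iff_ne_bot.2 (hf.ne_bot x))
  obtain ⟨p, b, h, -⟩ := hf.exists_affine_minorant_gt hr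
  exact ⟨p, b, h⟩

theorem coe_inner_sub_le_conj (f : EuclideanSpace ℝ (Fin n) → EReal)
    (p x : EuclideanSpace ℝ (Fin n)) : ((inner ℝ p x : ℝ) : EReal) - f x ≤ conj f p :=
  le_iSup (fun x => ((inner ℝ p x : ℝ) : EReal) - f x) x

theorem conj_conj_le (f : EuclideanSpace ℝ (Fin n) → EReal) (x : EuclideanSpace ℝ (Fin n)) :
    conj (conj f) x ≤ f x := by
  induction hu : f x with
  | bot =>
    refine iSup_le fun p => ?_
    have h := coe_inner_sub_le_conj f p x
    rw [hu, EReal.coe_sub_bot, top_le_iff] at h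
    simp [h]
  | top => exact le_top
  | coe r =>
    refine conj_le_coe_iff.2 fun p => ?_
    have h := coe_inner_sub_le_conj f p x
    rwa [hu, real_inner_comm] at h

/-- The Fenchel-Moreau theorem. -/
theorem Gamma0.le_conj_conj (hf : Gamma0 f) (x : EuclideanSpace ℝ (Fin n)) :
    f x ≤ conj (conj f) x := by
  refine EReal.ge_of_forall_gt_iff_ge.1 fun r hr => ?_
  obtain ⟨p, b, h1, h2⟩ := hf.exists_affine_minorant_gt hr
  have h3 : conj f p ≤ ((-b : ℝ) : EReal) := conj_le_coe_iff.2 fun y => by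
    simpa using h1 y
  calc (r : EReal) ≤ ((inner ℝ x p : ℝ) : EReal) - ((-b : ℝ) : EReal) := by
        rw [real_inner_comm]
        exact_mod_cast (by linarith : r ≤ inner ℝ p x - (-b))
    _ ≤ ((inner ℝ x p : ℝ) : EReal) - conj f p := EReal.sub_le_sub le_rfl h3
    _ ≤ conj (conj f) x := coe_inner_sub_le_conj _ _ _

theorem conj_ne_bot (hf : (dom f).Nonempty) (p : EuclideanSpace ℝ (Fin n)) : conj f p ≠ ⊥ := by
  obtain ⟨x, hx⟩ := hf
  intro h
  have h1 := coe_inner_sub_le_conj f p x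
  rw [h, le_bot_iff, sub_eq_add_neg, EReal.add_eq_bot_iff] at h1
  rcases h1 with h1 | h1
  · exact EReal.coe_ne_bot _ h1
  · exact (ne_of_lt hx) (EReal.neg_eq_bot_iff.1 h1)

theorem lowerSemicontinuous_conj (f : EuclideanSpace ℝ (Fin n) → EReal) :
    LowerSemicontinuous (conj f) := by
  refine lowerSemicontinuous_iSup fun x => ?_
  induction f x with
  | bot => simpa using lowerSemicontinuous_const
  | top => simpa using lowerSemicontinuous_const
  | coe r =>
    refine Continuous.lowerSemicontinuous ?_
    simp only [← EReal.coe_sub]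
    exact continuous_coe_real_ereal.comp (by fun_prop)

theorem conj_convex (f : EuclideanSpace ℝ (Fin n) → EReal) (p q : EuclideanSpace ℝ (Fin n))
    {a b : ℝ} (ha : 0 < a) (hb : 0 < b) (hab : a + b = 1) :
    conj f (a • p + b • q) ≤ (a : EReal) * conj f p + (b : EReal) * conj f q := by
  refine iSup_le fun x => ?_
  have hp := coe_inner_sub_le_conj f p x
  have hq := coe_inner_sub_le_conj f q x
  induction hu : f x with
  | bot =>
    rw [hu, EReal.coe_sub_bot, top_le_iff] at hp hq
    simp [hp, hq, EReal.coe_mul_top_of_pos ha, EReal.coe_mul_top_of_pos hb]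
  | top => simp
  | coe r =>
    rw [hu] at hp hq
    refine le_trans (le_of_eq ?_) (add_le_add
      (mul_le_mul_of_nonneg_left hp (EReal.coe_nonneg.2 ha.le))
      (mul_le_mul_of_nonneg_left hq (EReal.coe_nonneg.2 hb.le)))
    norm_cast
    rw [inner_add_left, inner_smul_left, inner_smul_left]
    simp only [RCLike.conj_to_real]
    linear_combination r * hab

theorem Gamma0.conj (hf : Gamma0 f) : Gamma0 (conj f) where
  ne_bot := conj_ne_bot hf.dom_nonempty
  dom_nonempty := by
    obtain ⟨p, b, h⟩ := hf.exists_affine_minorant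
    exact ⟨p, (conj_le_coe_iff (c := -b).2 fun y => by simpa using h y).trans_lt
      (EReal.coe_lt_top _)⟩
  convex _ _ _ _ := conj_convex f _ _
  lsc := lowerSemicontinuous_conj f

/-- Outside a ball f dominates ‖p‖ ‖x‖, and so ⟨p, x⟩; inside it an affine minorant of f bounds ⟨p,
x⟩ - f(x). -/
theorem OneCoercive.conj_lt_top (hf : Gamma0 f) (hc : OneCoercive f)
    (p : EuclideanSpace ℝ (Fin n)) : HJ.conj f p < ⊤ := by
  obtain ⟨q, b, hqb⟩ := hf.exists_affine_minorant
  have h1 := hc.eventually (lt_mem_nhds (EReal.coe_lt_top ‖p‖))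
  rw [(hasBasis_cobounded_norm).eventually_iff] at h1
  obtain ⟨R, -, hR⟩ := h1
  refine (conj_le_coe_iff (c := max 0 (‖p‖ * |R| + ‖q‖ * |R| - b)).2 fun x => ?_).trans_lt
    (EReal.coe_lt_top _)
  have hpx := real_inner_le_norm p x
  -- The radius R may be nonpositive, so x = 0 must be kept out of the quotient f(x)/‖x‖.
  by_cases hx : R ≤ ‖x‖ ∧ 0 < ‖x‖
  · have h2 := hR hx.1
    rw [EReal.lt_div_iff (EReal.coe_pos.2 hx.2) (EReal.coe_ne_top _)] at h2
    refine le_trans ?_ h2.le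
    norm_cast
    linarith [le_max_left 0 (‖p‖ * |R| + ‖q‖ * |R| - b)]
  · have hx' : ‖x‖ ≤ |R| := by
      by_cases h : R ≤ ‖x‖
      · have : ‖x‖ ≤ 0 := by
          by_contra! h'
          exact hx ⟨h, h'⟩
        exact this.trans (abs_nonneg R)
      · exact (not_le.1 h).le.trans (le_abs_self R)
    refine le_trans ?_ (hqb x)
    norm_cast
    have hqx := neg_le_of_abs_le (abs_real_inner_le_norm q x)
    have h3 : ‖p‖ * ‖x‖ ≤ ‖p‖ * |R| := by gcongr
    have h4 : ‖q‖ * ‖x‖ ≤ ‖q‖ * |R| := by gcongr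
    linarith [le_max_right 0 (‖p‖ * |R| + ‖q‖ * |R| - b)]

end Conjugate

/-! ### Duality for the value function -/

section ValueFunction

variable {n : ℕ} {J H : EuclideanSpace ℝ (Fin n) → EReal}

theorem OneCoercive.coe_re_conj (hJ : Gamma0 J) (hJc : OneCoercive J)
    (p : EuclideanSpace ℝ (Fin n)) : ((re (conj J) p : ℝ) : EReal) = conj J p :=
  hJ.conj.coe_re (hJc.conj_lt_top hJ p)

theorem OneCoercive.convexOn_re_conj (hJ : Gamma0 J) (hJc : OneCoercive J) :
    ConvexOn ℝ Set.univ (re (conj J)) := by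
  have h := hJ.conj.convexOn_re
  rwa [show dom (conj J) = Set.univ from Set.eq_univ_of_forall (hJc.conj_lt_top hJ)] at h

theorem OneCoercive.continuous_re_conj (hJ : Gamma0 J) (hJc : OneCoercive J) :
    Continuous (re (conj J)) :=
  (hJc.convexOn_re_conj hJ).locallyLipschitz.continuous

/-- Weak duality. -/
theorem affine_le_additiveObjective (hJ : Gamma0 J) (hJc : OneCoercive J) (hH : Gamma0 H)
    {p : EuclideanSpace ℝ (Fin n)} (hp : p ∈ dom H) (x : EuclideanSpace ℝ (Fin n)) {t : ℝ}
    (ht : 0 < t) (v : EuclideanSpace ℝ (Fin n)) :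
    ((inner ℝ p x - t * re H p - re (conj J) p : ℝ) : EReal) ≤ additiveObjective J H x t v := by
  have h1 := conj_le_coe_iff.1 (hJc.coe_re_conj hJ p).ge (x - t • v)
  have h2 := coe_inner_sub_le_conj H v p
  rw [← hH.coe_re hp] at h2
  have h3 := add_le_add h1 (mul_le_mul_of_nonneg_left h2 (EReal.coe_nonneg.2 ht.le))
  refine le_trans (le_of_eq ?_) h3
  norm_cast
  rw [inner_sub_right, inner_smul_right, real_inner_comm p v]
  ring

/-- Strong duality with attainment, for positive times. -/
theorem exists_additiveObjective_le (hJ : Gamma0 J) (hJc : OneCoercive J) (hH : Gamma0 H)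
    {x : EuclideanSpace ℝ (Fin n)} {t : ℝ} (ht : 0 < t) {c : ℝ}
    (hc : ∀ p ∈ dom H, inner ℝ p x - t * re H p - re (conj J) p ≤ c) :
    ∃ v, additiveObjective J H x t v ≤ c := by
  have hconc : ConcaveOn ℝ (dom H) fun p => inner ℝ p x - t * re H p - c := by
    have hconv := hH.convexOn_re
    refine ⟨hconv.1, fun p hp q hq a b ha hb hab => ?_⟩
    have h := hconv.2 hp hq ha hb hab
    simp only [smul_eq_mul] at h ⊢
    rw [inner_add_left, inner_smul_left, inner_smul_left]
    simp only [RCLike.conj_to_real]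
    nlinarith [mul_le_mul_of_nonneg_left h ht.le, congrArg (· * c) hab]
  obtain ⟨p₀, hp₀⟩ := hH.dom_nonempty
  -- An affine function ⟨y, p⟩ + b fits between ⟨p, x⟩ - t H(p) - c and J*(p). The upper bound gives
  -- J(y) ≤ -b, the lower one t H*(v) ≤ c + b for v = (x - y)/t, and these add up to c.
  obtain ⟨l, b, h1, h2⟩ := exists_affine_between isOpen_univ (hJc.convexOn_re_conj hJ)
    (hJc.continuous_re_conj hJ).continuousOn hconc ⟨p₀, hp₀, Set.mem_univ _⟩
    fun p hp => by linarith [hc p hp.1]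
  set y := (InnerProductSpace.toDual ℝ _).symm l with hy
  have hl : ∀ p, l p = inner ℝ y p := fun p => by simp [hy]
  simp only [hl] at h1 h2
  have hJy : J y ≤ ((-b : ℝ) : EReal) := (hJ.le_conj_conj y).trans <| conj_le_coe_iff.2 fun p => by
    rw [← hJc.coe_re_conj hJ]
    norm_cast
    linarith [h2 p (Set.mem_univ p)]
  have hHv : conj H (t⁻¹ • (x - y)) ≤ ((t⁻¹ * (c + b) : ℝ) : EReal) := conj_le_coe_iff.2 fun p => by
    by_cases hp : p ∈ dom H
    · rw [← hH.coe_re hp]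
      norm_cast
      rw [inner_smul_left, RCLike.conj_to_real, ← mul_sub, inv_mul_le_iff₀ ht, inner_sub_left,
        real_inner_comm p x]
      linarith [h1 p hp]
    · rw [show H p = ⊤ from not_lt_top_iff.1 hp]
      exact le_top
  refine ⟨t⁻¹ • (x - y), ?_⟩
  rw [additiveObjective, smul_inv_smul₀ ht.ne', sub_sub_cancel]
  refine (add_le_add hJy (mul_le_mul_of_nonneg_left hHv (EReal.coe_nonneg.2 ht.le))).trans
    (le_of_eq ?_)
  norm_cast
  rw [mul_inv_cancel_left₀ ht.ne']
  ring

theorem valueFn_of_pos {t : ℝ} (ht : 0 < t) (x : EuclideanSpace ℝ (Fin n)) :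
    valueFn J H (x, t) = ⨅ v, additiveObjective J H x t v := by
  simp [valueFn, ht]

theorem valueFn_zero (x : EuclideanSpace ℝ (Fin n)) :
    valueFn J H (x, 0) = conj (fun p => conj J p + ind (dom H) p) x := by
  simp [valueFn]

theorem nonneg_of_mem_dom_valueFn {z : EuclideanSpace ℝ (Fin n) × ℝ}
    (hz : z ∈ dom (valueFn J H)) : 0 ≤ z.2 := by
  by_contra! h
  have : valueFn J H z < ⊤ := hz
  simp [valueFn, h.not_gt, h.ne] at this

/-- At nonnegative times the value function is the supremum of the affine functions
`(x, t) ↦ ⟨p, x⟩ - t H(p) - J*(p)`, `p ∈ dom H`. -/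
theorem valueFn_le_coe_iff (hJ : Gamma0 J) (hJc : OneCoercive J) (hH : Gamma0 H)
    {x : EuclideanSpace ℝ (Fin n)} {t : ℝ} (ht : 0 ≤ t) {c : ℝ} :
    valueFn J H (x, t) ≤ c ↔
      ∀ p ∈ dom H, inner ℝ p x - t * re H p - re (conj J) p ≤ c := by
  rcases ht.lt_or_eq with ht | rfl
  · rw [valueFn_of_pos ht]
    constructor
    · intro h p hp
      have := (le_iInf (affine_le_additiveObjective hJ hJc hH hp x ht)).trans h
      exact_mod_cast this
    · intro h
      obtain ⟨v, hv⟩ := exists_additiveObjective_le hJ hJc hH ht h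
      exact (iInf_le _ v).trans hv
  · rw [valueFn_zero, conj_le_coe_iff]
    refine forall_congr' fun p => ?_
    by_cases hp : p ∈ dom H
    · simp only [ind, hp, if_true, add_zero, forall_true_left]
      rw [← hJc.coe_re_conj hJ, EReal.coe_le_coe_iff, real_inner_comm]
      constructor <;> intro h <;> linarith
    · simp [ind, hp, EReal.add_top_of_ne_bot (hJ.conj.ne_bot p)]

theorem valueFn_ne_bot (hJ : Gamma0 J) (hJc : OneCoercive J) (hH : Gamma0 H)
    (z : EuclideanSpace ℝ (Fin n) × ℝ) : valueFn J H z ≠ ⊥ := by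
  obtain ⟨x, t⟩ := z
  rcases lt_or_ge t 0 with ht | ht
  · simp [valueFn, ht.not_gt, ht.ne]
  · intro h
    obtain ⟨p, hp⟩ := hH.dom_nonempty
    have := (valueFn_le_coe_iff hJ hJc hH ht
      (c := inner ℝ p x - t * re H p - re (conj J) p - 1)).1 (by rw [h]; exact bot_le) p hp
    linarith

theorem coe_re_valueFn (hJ : Gamma0 J) (hJc : OneCoercive J) (hH : Gamma0 H)
    {z : EuclideanSpace ℝ (Fin n) × ℝ} (hz : z ∈ dom (valueFn J H)) :
    ((re (valueFn J H) z : ℝ) : EReal) = valueFn J H z :=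
  EReal.coe_toReal (ne_of_lt hz) (valueFn_ne_bot hJ hJc hH z)

/-- Joint convexity in (x, t), since for t ≥ 0 the function is a supremum of affine ones. -/
theorem convexOn_re_valueFn (hJ : Gamma0 J) (hJc : OneCoercive J) (hH : Gamma0 H) :
    ConvexOn ℝ (dom (valueFn J H)) (re (valueFn J H)) := by
  have key : ∀ z ∈ dom (valueFn J H), ∀ w ∈ dom (valueFn J H), ∀ a b : ℝ, 0 < a → 0 < b →
      a + b = 1 → valueFn J H (a • z + b • w) ≤
        ((a * re (valueFn J H) z + b * re (valueFn J H) w : ℝ) : EReal) := by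
    rintro ⟨x, s⟩ hz ⟨y, t⟩ hw a b ha hb hab
    have hs : 0 ≤ s := nonneg_of_mem_dom_valueFn hz
    have ht : 0 ≤ t := nonneg_of_mem_dom_valueFn hw
    have h1 := (valueFn_le_coe_iff hJ hJc hH hs).1 (coe_re_valueFn hJ hJc hH hz).ge
    have h2 := (valueFn_le_coe_iff hJ hJc hH ht).1 (coe_re_valueFn hJ hJc hH hw).ge
    rw [Prod.smul_mk, Prod.smul_mk, Prod.mk_add_mk]
    refine (valueFn_le_coe_iff hJ hJc hH (by simp only [smul_eq_mul]; positivity)).2 fun p hp => ?_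
    have h1 := mul_le_mul_of_nonneg_left (h1 p hp) ha.le
    have h2 := mul_le_mul_of_nonneg_left (h2 p hp) hb.le
    simp only [smul_eq_mul, inner_add_right, inner_smul_right]
    have : re (conj J) p = a * re (conj J) p + b * re (conj J) p := by rw [← add_mul, hab, one_mul]
    linarith
  refine convexOn_iff_forall_pos.2 ⟨convex_iff_forall_pos.2 fun x hx y hy a b ha hb hab =>
    (key x hx y hy a b ha hb hab).trans_lt (EReal.coe_lt_top _),
    fun x hx y hy a b ha hb hab => ?_⟩
  have h := key x hx y hy a b ha hb hab
  rw [← coe_re_valueFn hJ hJc hH (h.trans_lt (EReal.coe_lt_top _))] at h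
  exact_mod_cast h

theorem pos_of_mem_interior_dom_valueFn {x : EuclideanSpace ℝ (Fin n)} {t : ℝ}
    (hz : (x, t) ∈ interior (dom (valueFn J H))) : 0 < t := by
  have h1 : Tendsto (fun s : ℝ => (x, s)) (𝓝 t) (𝓝 (x, t)) :=
    (Continuous.prodMk_right x).tendsto t
  have h2 := h1.eventually (mem_interior_iff_mem_nhds.1 hz)
  obtain ⟨ε, hε, h3⟩ := Metric.eventually_nhds_iff.1 h2
  have h4 := h3 (y := t - ε / 2) (by simp [abs_of_pos hε]; linarith)
  have := nonneg_of_mem_dom_valueFn h4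
  simp at this
  linarith

theorem Gamma0.conj_lt_top_of_additiveObjective_lt_top (hJ : Gamma0 J) (hH : Gamma0 H)
    {x v : EuclideanSpace ℝ (Fin n)} {t : ℝ} (ht : 0 < t)
    (h : additiveObjective J H x t v < ⊤) : J (x - t • v) < ⊤ ∧ HJ.conj H v < ⊤ := by
  have hb := hH.conj.ne_bot v
  have htb : (t : EReal) * HJ.conj H v ≠ ⊥ := by
    intro h'
    rw [EReal.mul_eq_bot] at h'
    simp [hb, ht.not_gt] at h'
  constructor
  · by_contra! h'
    rw [additiveObjective, top_le_iff.1 h', EReal.top_add_of_ne_bot htb] at h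
    exact lt_irrefl _ h
  · by_contra! h'
    rw [additiveObjective, top_le_iff.1 h', EReal.coe_mul_top_of_pos ht,
      EReal.add_top_of_ne_bot (hJ.ne_bot _)] at h
    exact lt_irrefl _ h

/-- Duality with the bound c = S(x, t) yields the minimizer; no compactness argument is needed. -/
theorem exists_additiveObjective_eq_valueFn (hJ : Gamma0 J) (hJc : OneCoercive J) (hH : Gamma0 H)
    {x : EuclideanSpace ℝ (Fin n)} {t : ℝ} (ht : 0 < t) (hz : (x, t) ∈ dom (valueFn J H)) :
    ∃ v, additiveObjective J H x t v = valueFn J H (x, t) := by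
  have h := (valueFn_le_coe_iff hJ hJc hH ht.le).1 (coe_re_valueFn hJ hJc hH hz).ge
  obtain ⟨v, hv⟩ := exists_additiveObjective_le hJ hJc hH ht h
  rw [coe_re_valueFn hJ hJc hH hz] at hv
  refine ⟨v, hv.antisymm ?_⟩
  rw [valueFn_of_pos ht]
  exact iInf_le _ v

end ValueFunction

/-! ### Subgradients and differentiability of the value function -/

section Differentiability

variable {n : ℕ} {J H : EuclideanSpace ℝ (Fin n) → EReal}

/-- A subgradient of the value function at an interior point has the form `(p, -H(p))`, where every
minimizer of the objective belongs to `∂H(p)`. -/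
theorem subgradient_valueFn (hJ : Gamma0 J) (hJc : OneCoercive J) (hH : Gamma0 H)
    {x : EuclideanSpace ℝ (Fin n)} {t : ℝ} (hz : (x, t) ∈ interior (dom (valueFn J H)))
    {l : EuclideanSpace ℝ (Fin n) × ℝ →L[ℝ] ℝ}
    (hl : ∀ w ∈ interior (dom (valueFn J H)),
      re (valueFn J H) (x, t) + l (w - (x, t)) ≤ re (valueFn J H) w)
    {p : EuclideanSpace ℝ (Fin n)} (hp : ∀ y, l (y, 0) = inner ℝ p y)
    {v : EuclideanSpace ℝ (Fin n)} (hv : additiveObjective J H x t v = valueFn J H (x, t)) :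
    p ∈ dom H ∧ v ∈ subdiff H p ∧ l (0, 1) = -re H p := by
  have ht := pos_of_mem_interior_dom_valueFn hz
  have hlin : ∀ y s, l (y, s) = inner ℝ p y + s * l (0, 1) := by
    intro y s
    have : ((y, s) : EuclideanSpace ℝ (Fin n) × ℝ) = (y, 0) + s • (0, 1) := by simp
    rw [this, map_add, map_smul, hp, smul_eq_mul]
  have hzd := interior_subset hz
  obtain ⟨hy : x - t • v ∈ dom J, hvd : v ∈ dom (conj H)⟩ :=
    hJ.conj_lt_top_of_additiveObjective_lt_top hH ht (hv.trans_lt hzd)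
  set y := x - t • v with hydef
  have hx : x = y + t • v := by simp [hydef]
  have hS : re (valueFn J H) (x, t) = re J y + t * re (conj H) v := by
    rw [← coe_re_valueFn hJ hJc hH hzd, additiveObjective, ← hydef, ← hJ.coe_re hy,
      ← hH.conj.coe_re hvd] at hv
    exact_mod_cast hv.symm
  -- Using w as a trial velocity keeps the starting point y fixed.
  have hupper : ∀ w ∈ dom (conj H), ∀ s, (y + s • w, s) ∈ interior (dom (valueFn J H)) →
      re (valueFn J H) (y + s • w, s) ≤ re J y + s * re (conj H) w := by
    intro w hw s hs
    have hs0 := pos_of_mem_interior_dom_valueFn hs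
    have h := iInf_le (additiveObjective J H (y + s • w) s) w
    rw [← valueFn_of_pos hs0, additiveObjective, add_sub_cancel_right, ← hJ.coe_re hy,
      ← hH.conj.coe_re hw, ← coe_re_valueFn hJ hJc hH (interior_subset hs)] at h
    exact_mod_cast h
  have hnhds := isOpen_interior.mem_nhds hz
  -- p ∈ ∂H*(v): at fixed time move the velocity a small step r from v towards w, which stays in the
  -- interior, then use convexity of H* on the segment.
  have hsub : ∀ w ∈ dom (conj H), re (conj H) v + inner ℝ p (w - v) ≤ re (conj H) w := by
    intro w hw
    have hcont : Tendsto (fun r : ℝ => (y + t • (v + r • (w - v)), t)) (𝓝 0) (𝓝 (x, t)) := by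
      have : Continuous fun r : ℝ => (y + t • (v + r • (w - v)), t) := by fun_prop
      convert this.tendsto 0 using 2
      simp [hx]
    obtain ⟨ε, hε, hball⟩ := Metric.eventually_nhds_iff.1 (hcont.eventually hnhds)
    set r := min (ε / 2) (1 / 2) with hr
    have hr0 : 0 < r := by positivity
    have hr1 : r < 1 := (min_le_right _ _).trans_lt (by norm_num)
    have hmem := hball (y := r) (by
      rw [Real.dist_eq, sub_zero, abs_of_pos hr0]
      exact (min_le_left _ _).trans_lt (by linarith))
    have hcomb : v + r • (w - v) = (1 - r) • v + r • w := by
      rw [smul_sub, sub_smul, one_smul]; abel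
    have hd : v + r • (w - v) ∈ dom (conj H) := by
      rw [hcomb]
      exact hH.conj.convexOn_re.1 hvd hw (by linarith) hr0.le (by ring)
    have h1 := hupper _ hd t hmem
    have h2 := hl _ hmem
    have h3 := hH.conj.convexOn_re.2 hvd hw (by linarith : 0 ≤ 1 - r) hr0.le (by ring)
    rw [← hcomb, smul_eq_mul, smul_eq_mul] at h3
    have h4 : ((y + t • (v + r • (w - v)), t) : EuclideanSpace ℝ (Fin n) × ℝ) - (x, t)
        = ((t * r) • (w - v), 0) := by
      rw [hx, Prod.mk_sub_mk, smul_add, smul_smul]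
      simp
    rw [h4, hp, inner_smul_right, hS] at h2
    have h5 := mul_le_mul_of_nonneg_left h3 ht.le
    have h6 : 0 < t * r := by positivity
    have h7 : t * r * (re (conj H) v + inner ℝ p (w - v)) ≤ t * r * re (conj H) w := by linarith
    exact le_of_mul_le_mul_left h7 h6
  have hpH : H p ≤ ((inner ℝ p v - re (conj H) v : ℝ) : EReal) := by
    refine (hH.le_conj_conj p).trans (conj_le_coe_iff.2 fun w => ?_)
    by_cases hw : w ∈ dom (conj H)
    · rw [← hH.conj.coe_re hw]
      have := hsub w hw
      rw [inner_sub_right] at this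
      norm_cast
      linarith
    · rw [show conj H w = ⊤ from not_lt_top_iff.1 hw]
      exact le_top
  have hpd : p ∈ dom H := hpH.trans_lt (EReal.coe_lt_top _)
  have hconj := conj_le_coe_iff.1 (hH.conj.coe_re hvd).ge
  have hHp : re H p = inner ℝ p v - re (conj H) v := by
    have h1 := hconj p
    rw [← hH.coe_re hpd] at h1 hpH
    norm_cast at h1 hpH
    rw [real_inner_comm] at h1
    linarith
  refine ⟨hpd, fun q => ?_, ?_⟩
  · refine le_trans (le_of_eq ?_) (hconj q)
    rw [← hH.coe_re hpd]
    norm_cast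
    rw [hHp, inner_sub_right, real_inner_comm p v]
    ring
  -- Along the ray through (x, t) the upper bound is affine in s and touches S at s = t; steps of
  -- both signs force its slope H*(v) to equal ⟨p, v⟩ + l(0, 1).
  · have hcont : Tendsto (fun s : ℝ => (y + s • v, s)) (𝓝 t) (𝓝 (x, t)) := by
      have : Continuous fun s : ℝ => (y + s • v, s) := by fun_prop
      convert this.tendsto t using 2
      rw [hx]
    obtain ⟨ε, hε, hball⟩ := Metric.eventually_nhds_iff.1 (hcont.eventually hnhds)
    have key : ∀ d : ℝ, |d| < ε → d * (inner ℝ p v + l (0, 1) - re (conj H) v) ≤ 0 := by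
      intro d hd
      have hmem := hball (y := t + d) (by rw [Real.dist_eq, add_sub_cancel_left]; exact hd)
      have h1 := hupper v hvd _ hmem
      have h2 := hl _ hmem
      have h3 : ((y + (t + d) • v, t + d) : EuclideanSpace ℝ (Fin n) × ℝ) - (x, t)
          = (d • v, d) := by
        rw [hx, Prod.mk_sub_mk, add_smul, ← add_assoc, add_sub_cancel_left, add_sub_cancel_left]
      rw [h3, hlin, inner_smul_right, hS] at h2
      linarith
    have h1 := key (ε / 2) (by rw [abs_of_pos (by linarith)]; linarith)
    have h2 := key (-(ε / 2)) (by rw [abs_neg, abs_of_pos (by linarith)]; linarith)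
    rw [hHp]
    nlinarith

theorem IsLegendre.mem_interior_of_mem_subdiff (hH : IsLegendre H)
    {p v : EuclideanSpace ℝ (Fin n)} (hp : p ∈ dom H) (hv : v ∈ subdiff H p) :
    p ∈ interior (dom H) := by
  by_contra h
  have := hH.subdiff_boundary p ⟨hp, h⟩
  rw [this] at hv
  exact hv

/-- Averaging the two subgradient inequalities at the midpoint of p and q contradicts strict
convexity. -/
theorem IsLegendre.eq_of_mem_subdiff (hH : IsLegendre H) {p q v : EuclideanSpace ℝ (Fin n)}
    (hp : p ∈ dom H) (hq : q ∈ dom H) (hpv : v ∈ subdiff H p) (hqv : v ∈ subdiff H q) :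
    p = q := by
  by_contra hne
  have hpi := hH.mem_interior_of_mem_subdiff hp hpv
  have hqi := hH.mem_interior_of_mem_subdiff hq hqv
  have h1 := hH.strictConvex.2 hpi hqi hne (by norm_num : (0 : ℝ) < 1 / 2)
    (by norm_num : (0 : ℝ) < 1 / 2) (by norm_num)
  have hm := interior_subset (hH.strictConvex.1 hpi hqi (by norm_num : (0 : ℝ) ≤ 1 / 2)
    (by norm_num : (0 : ℝ) ≤ 1 / 2) (by norm_num))
  have h2 := hpv ((1 / 2 : ℝ) • p + (1 / 2 : ℝ) • q)
  have h3 := hqv ((1 / 2 : ℝ) • p + (1 / 2 : ℝ) • q)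
  rw [← hH.gamma0.coe_re hm, ← hH.gamma0.coe_re hp] at h2
  rw [← hH.gamma0.coe_re hm, ← hH.gamma0.coe_re hq] at h3
  norm_cast at h2 h3
  simp only [inner_sub_right, inner_add_right, inner_smul_right, smul_eq_mul] at h1 h2 h3
  linarith

theorem hasFDerivAt_valueFn (hJ : Gamma0 J) (hJc : OneCoercive J) (hH : IsLegendre H)
    {x : EuclideanSpace ℝ (Fin n)} {t : ℝ} (hz : (x, t) ∈ interior (dom (valueFn J H))) :
    ∃ (l : EuclideanSpace ℝ (Fin n) × ℝ →L[ℝ] ℝ) (p : EuclideanSpace ℝ (Fin n)),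
      HasFDerivAt (re (valueFn J H)) l (x, t) ∧ (∀ y, l (y, 0) = inner ℝ p y) ∧
      l (0, 1) = -re H p ∧ p ∈ interior (dom H) ∧
      ∀ v, additiveObjective J H x t v = valueFn J H (x, t) → v ∈ subdiff H p := by
  have hconv := (convexOn_re_valueFn hJ hJc hH.gamma0).subset interior_subset
    (convexOn_re_valueFn hJ hJc hH.gamma0).1.interior
  obtain ⟨l, hl⟩ := exists_subgradient isOpen_interior hconv hz
  have repr : ∀ m : EuclideanSpace ℝ (Fin n) × ℝ →L[ℝ] ℝ,
      ∃ p, ∀ y, m (y, 0) = inner ℝ p y := fun m =>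
    ⟨(InnerProductSpace.toDual ℝ _).symm (m.comp (.inl ℝ (EuclideanSpace ℝ (Fin n)) ℝ)),
      fun y => by simp⟩
  obtain ⟨p, hp⟩ := repr l
  obtain ⟨v, hv⟩ := exists_additiveObjective_eq_valueFn hJ hJc hH.gamma0
    (pos_of_mem_interior_dom_valueFn hz) (interior_subset hz)
  obtain ⟨hpd, hvp, hl1⟩ := subgradient_valueFn hJ hJc hH.gamma0 hz hl hp hv
  refine ⟨l, p, hasFDerivAt_of_unique_subgradient isOpen_interior hconv hz fun l' hl' => ?_,
    hp, hl1, hH.mem_interior_of_mem_subdiff hpd hvp,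
    fun w hw => (subgradient_valueFn hJ hJc hH.gamma0 hz hl hp hw).2.1⟩
  obtain ⟨q, hq⟩ := repr l'
  obtain ⟨hqd, hvq, hl1'⟩ := subgradient_valueFn hJ hJc hH.gamma0 hz hl' hq hv
  -- The same minimizer v serves both subgradients, so it lies in ∂H(p) ∩ ∂H(q).
  obtain rfl := hH.eq_of_mem_subdiff hpd hqd hvp hvq
  ext y
  · simp [hp, hq]
  · simp [hl1, hl1']

theorem valueFn_derivatives (hJ : Gamma0 J) (hJc : OneCoercive J) (hH : IsLegendre H)
    {x : EuclideanSpace ℝ (Fin n)} {t : ℝ} (hz : (x, t) ∈ interior (dom (valueFn J H))) :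
    DifferentiableAt ℝ (re (valueFn J H)) (x, t) ∧
    partialT (valueFn J H) x t = -re H (gradX (valueFn J H) x t) ∧
    gradX (valueFn J H) x t ∈ interior (dom H) ∧
    ∀ v, additiveObjective J H x t v = valueFn J H (x, t) →
      v ∈ subdiff H (gradX (valueFn J H) x t) := by
  obtain ⟨l, p, hl, hlp, hl1, hp, hv⟩ := hasFDerivAt_valueFn hJ hJc hH hz
  have hgrad : gradX (valueFn J H) x t = p := by
    refine HasGradientAt.gradient ?_
    rw [hasGradientAt_iff_hasFDerivAt]
    have h : HasFDerivAt (fun y => re (valueFn J H) (y, t)) _ x :=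
      HasFDerivAt.comp (g := re (valueFn J H)) x hl (hasFDerivAt_prodMk_left x t)
    refine h.congr_fderiv ?_
    ext y
    simp [hlp]
  have hpart : partialT (valueFn J H) x t = -re H p := by
    refine HasDerivAt.deriv ?_
    have h : HasDerivAt (fun s => re (valueFn J H) (x, s)) _ t :=
      (HasFDerivAt.comp (g := re (valueFn J H)) t hl (hasFDerivAt_prodMk_right x t)).hasDerivAt
    simpa [hl1] using h
  rw [hgrad]
  exact ⟨hl.differentiableAt, hpart, hp, hv⟩

theorem mem_interior_dom_valueFn (hJ : Gamma0 J) (hH : Gamma0 H)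
    {x : EuclideanSpace ℝ (Fin n)} {t : ℝ} (ht : 0 < t)
    (hx : x ∈ dom J + t • interior (dom (conj H))) :
    (x, t) ∈ interior (dom (valueFn J H)) := by
  obtain ⟨y, hy, -, ⟨v, hv, rfl⟩, rfl⟩ := hx
  -- The velocity (x' - y)/t' joins y to a nearby (x', t') and stays in int dom H*, so it is a trial
  -- of finite cost.
  have hcont : ContinuousAt (fun z : EuclideanSpace ℝ (Fin n) × ℝ => z.2⁻¹ • (z.1 - y))
      (y + t • v, t) := by
    exact ContinuousAt.smul (continuousAt_snd.inv₀ ht.ne') (by fun_prop)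
  have h1 : ∀ᶠ z : EuclideanSpace ℝ (Fin n) × ℝ in 𝓝 (y + t • v, t),
      z.2⁻¹ • (z.1 - y) ∈ interior (dom (conj H)) :=
    hcont.eventually_mem (isOpen_interior.mem_nhds (by simpa [ht.ne'] using hv))
  have h2 : ∀ᶠ z : EuclideanSpace ℝ (Fin n) × ℝ in 𝓝 (y + t • v, t), 0 < z.2 :=
    continuousAt_snd.eventually (lt_mem_nhds ht)
  refine mem_interior_iff_mem_nhds.2 ?_
  filter_upwards [h1, h2]
  rintro ⟨x', t'⟩ (h1 : t'⁻¹ • (x' - y) ∈ _) (h2 : 0 < t')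
  change valueFn J H (x', t') < ⊤
  rw [valueFn_of_pos h2]
  refine (iInf_le _ (t'⁻¹ • (x' - y))).trans_lt ?_
  rw [additiveObjective, smul_inv_smul₀ h2.ne', sub_sub_cancel, ← hJ.coe_re hy,
    ← hH.conj.coe_re (interior_subset h1)]
  exact_mod_cast EReal.coe_lt_top (re J y + t' * re (conj H) (t'⁻¹ • (x' - y)))

end Differentiability

/-! ### The initial datum -/

section InitialDatum

variable {n : ℕ} {J H : EuclideanSpace ℝ (Fin n) → EReal}

theorem dom_add_ind (hJ : Gamma0 J) (hJc : OneCoercive J)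
    (C : Set (EuclideanSpace ℝ (Fin n))) : dom (fun p => conj J p + ind C p) = C := by
  ext p
  by_cases hp : p ∈ C
  · simpa [dom, ind, hp] using hJc.conj_lt_top hJ p
  · simp [dom, ind, hp, EReal.add_top_of_ne_bot (hJ.conj.ne_bot p)]

theorem gamma0_conj_add_ind (hJ : Gamma0 J) (hJc : OneCoercive J)
    {C : Set (EuclideanSpace ℝ (Fin n))} (hC : IsClosed C) (hconv : Convex ℝ C)
    (hne : C.Nonempty) : Gamma0 (fun p => conj J p + ind C p) where
  ne_bot p := by
    by_cases hp : p ∈ C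
    · simpa [ind, hp] using hJ.conj.ne_bot p
    · simp [ind, hp, EReal.add_top_of_ne_bot (hJ.conj.ne_bot p)]
  dom_nonempty := by rwa [dom_add_ind hJ hJc]
  convex p q a b ha hb hab := by
    have hbot : ∀ (r : EuclideanSpace ℝ (Fin n)) (c : ℝ), 0 < c →
        (c : EReal) * (conj J r + ind C r) ≠ ⊥ := by
      intro r c hc
      by_cases hr : r ∈ C
      · rw [← hJc.coe_re_conj hJ]
        simp only [ind, hr, if_true, add_zero]
        exact_mod_cast EReal.coe_ne_bot (c * re (conj J) r)
      · simp [ind, hr, EReal.add_top_of_ne_bot (hJ.conj.ne_bot r), EReal.coe_mul_top_of_pos hc]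
    by_cases hp : p ∈ C
    · by_cases hq : q ∈ C
      · have hpq := hconv hp hq ha.le hb.le hab
        simpa [ind, hp, hq, hpq] using hJ.conj.convex p q a b ha hb hab
      · have : (b : EReal) * (conj J q + ind C q) = ⊤ := by
          simp [ind, hq, EReal.add_top_of_ne_bot (hJ.conj.ne_bot q), EReal.coe_mul_top_of_pos hb]
        rw [this, EReal.add_top_of_ne_bot (hbot p a ha)]
        exact le_top
    · have : (a : EReal) * (conj J p + ind C p) = ⊤ := by
        simp [ind, hp, EReal.add_top_of_ne_bot (hJ.conj.ne_bot p), EReal.coe_mul_top_of_pos ha]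
      rw [this, EReal.top_add_of_ne_bot (hbot q b hb)]
      exact le_top
  lsc p u hu := by
    by_cases hp : p ∈ C
    · simp only [ind, hp, if_true, add_zero] at hu
      filter_upwards [hJ.conj.lsc p u hu] with q hq
      refine hq.trans_le (le_add_of_nonneg_right ?_)
      simp only [ind]
      split_ifs <;> simp
    · simp only [ind, hp, if_false, EReal.add_top_of_ne_bot (hJ.conj.ne_bot p)] at hu
      filter_upwards [hC.isOpen_compl.mem_nhds hp] with q (hq : q ∉ C)
      simpa only [ind, hq, if_false, EReal.add_top_of_ne_bot (hJ.conj.ne_bot q)] using hu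

theorem Gamma0.conj_conj (hf : Gamma0 J) : HJ.conj (HJ.conj J) = J :=
  funext fun x => (conj_conj_le J x).antisymm (hf.le_conj_conj x)

/-- Each bound on the conjugate says that the constraint set lies in a set which is closed by
continuity of J*. -/
theorem conj_add_ind_closure (hJ : Gamma0 J) (hJc : OneCoercive J)
    (C : Set (EuclideanSpace ℝ (Fin n))) :
    conj (fun p => conj J p + ind (closure C) p) = conj (fun p => conj J p + ind C p) := by
  have hiff : ∀ (D : Set (EuclideanSpace ℝ (Fin n))) x (c : ℝ),
      conj (fun p => conj J p + ind D p) x ≤ c ↔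
        D ⊆ {p | inner ℝ x p - c ≤ re (conj J) p} := by
    intro D x c
    rw [conj_le_coe_iff]
    refine forall_congr' fun p => ?_
    by_cases hp : p ∈ D
    · simp only [ind, hp, if_true, add_zero, forall_true_left, Set.mem_ofPred_eq]
      rw [← hJc.coe_re_conj hJ, EReal.coe_le_coe_iff]
    · simp [ind, hp, EReal.add_top_of_ne_bot (hJ.conj.ne_bot p)]
  ext x
  have hcl : ∀ c : ℝ, IsClosed {p | inner ℝ x p - c ≤ re (conj J) p} := fun c =>
    isClosed_le (by fun_prop) (hJc.continuous_re_conj hJ)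
  refine le_antisymm ?_ ?_ <;> refine EReal.le_of_forall_lt_iff_le.1 fun c hc => ?_
  · exact (hiff _ _ _).2 (closure_minimal ((hiff _ _ _).1 hc.le) (hcl c))
  · exact (hiff _ _ _).2 (subset_closure.trans ((hiff _ _ _).1 hc.le))

theorem exists_isInitialDatum (hJ : Gamma0 J) (hJc : OneCoercive J) (hH : Gamma0 H) :
    ∃ JS, IsInitialDatum J H JS := by
  have hg := gamma0_conj_add_ind hJ hJc isClosed_closure hH.convexOn_re.1.closure
    hH.dom_nonempty.closure
  have hdom := dom_add_ind hJ hJc (closure (dom H))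
  refine ⟨conj fun p => conj J p + ind (closure (dom H)) p, hg.conj, ?_, ?_⟩
  · rw [hg.conj_conj, hdom]
  · rw [hg.conj_conj, hdom]
    intro p hp
    simp [ind, hp]

/-- The defining conditions determine J_S* everywhere, and hence J_S by biconjugation. -/
theorem IsInitialDatum.valueFn_zero {JS : EuclideanSpace ℝ (Fin n) → EReal} (hJ : Gamma0 J)
    (hJc : OneCoercive J) (hJS : IsInitialDatum J H JS) (x : EuclideanSpace ℝ (Fin n)) :
    valueFn J H (x, 0) = JS x := by
  have h : conj JS = fun p => conj J p + ind (closure (dom H)) p := by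
    ext p
    by_cases hp : p ∈ dom (conj JS)
    · rw [hJS.conj_eq p hp]
      rw [hJS.dom_conj] at hp
      simp [ind, hp]
    · rw [show conj JS p = ⊤ from not_lt_top_iff.1 hp]
      rw [hJS.dom_conj] at hp
      simp [ind, hp, EReal.add_top_of_ne_bot (hJ.conj.ne_bot p)]
  rw [HJ.valueFn_zero, ← conj_add_ind_closure hJ hJc, ← h, hJS.gamma0.conj_conj]

end InitialDatum

end HJ

end

/-! ### The main theorem -/

theorem proposition3p2 (n : ℕ) (J H : EuclideanSpace ℝ (Fin n) → EReal)
    (hJ : HJ.Gamma0 J) (hH : HJ.Gamma0 H) (hJc : HJ.OneCoercive J) (hHL : HJ.IsLegendre H) :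
    -- the value function takes values in `ℝ ∪ {+∞}`
    (∀ z, HJ.valueFn J H z ≠ ⊥) ∧
    -- the initial datum exists, and the value function solves the Hamilton-Jacobi equation with it
    (∃ JS, HJ.IsInitialDatum J H JS) ∧
    (∀ JS, HJ.IsInitialDatum J H JS → HJ.SolvesHJ H (HJ.valueFn J H) JS) ∧
    -- the additive model has exactly one minimizer, namely `∇H(∇ₓ S(x, t))`
    (∀ (t : ℝ) (x : EuclideanSpace ℝ (Fin n)), 0 < t →
      x ∈ HJ.dom J + t • interior (HJ.dom (HJ.conj H)) →
      (x, t) ∈ interior (HJ.dom (HJ.valueFn J H)) ∧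
      HJ.gradX (HJ.valueFn J H) x t ∈ interior (HJ.dom H) ∧
      ∀ v : EuclideanSpace ℝ (Fin n),
        IsMinOn (HJ.additiveObjective J H x t) Set.univ v ↔
          v = ∇ (HJ.re H) (HJ.gradX (HJ.valueFn J H) x t)) := by
  refine ⟨HJ.valueFn_ne_bot hJ hJc hH, HJ.exists_isInitialDatum hJ hJc hH,
    fun JS hJS => ⟨fun x t hz => ?_, hJS.valueFn_zero hJ hJc⟩, fun t x ht hx => ?_⟩
  · obtain ⟨hd, hpart, hgrad, -⟩ := HJ.valueFn_derivatives hJ hJc hHL hz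
    refine ⟨hd, ?_⟩
    rw [hpart, ← hH.coe_re (interior_subset hgrad)]
    norm_cast
    exact neg_add_cancel _
  · have hz := HJ.mem_interior_dom_valueFn hJ hH ht hx
    obtain ⟨-, -, hgrad, hmin⟩ := HJ.valueFn_derivatives hJ hJc hHL hz
    rw [hHL.subdiff_interior _ hgrad] at hmin
    obtain ⟨v₀, hv₀⟩ := HJ.exists_additiveObjective_eq_valueFn hJ hJc hH ht (interior_subset hz)
    refine ⟨hz, hgrad, fun v => ⟨fun hv => hmin v ?_, ?_⟩⟩
    · rw [HJ.valueFn_of_pos ht]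
      exact (le_iInf fun w => isMinOn_univ_iff.1 hv w).antisymm (iInf_le _ v)
    · rintro rfl
      -- The attained minimizer v₀ must equal the gradient, which is therefore itself a minimizer.
      rw [← hmin v₀ hv₀, isMinOn_univ_iff]
      intro w
      rw [hv₀, HJ.valueFn_of_pos ht]
      exact iInf_le _ w
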